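/- Let $M=(S,\mathit{Act},\mathcal P,L)$ be a Markov decision process with finite sets $S$, $\mathit{Act}$ of states and actions, transition function $\mathcal P: S\times\mathit{Act}\to\mathit{Distr}(S)$ and labelling $L:S\to 2^{AP}$, $AP$ finite. A policy is a map from finite paths (sequences $s^0a^0s^1\dots s^n$ all of whose transitions have positive probability) to actions; it is memoryless if its value depends only on the last state of the path. A policy $\sigma$ induces the Markov chain $M^\sigma$ on finite paths that moves from a path $\pi$ with last state $s$ to $\pi\,\sigma(\pi)\,s'$ with probability $\mathcal P(s,\sigma(\pi),s')$; a path carries the label of its last state. Let $m\ge 1$. The $m$-self-composition is $M^m=(S^m,\mathit{Act}^m,\mathcal P^m,L^m)$ with $\mathcal P^m(\mathbf s,\mathbf a,\mathbf s')=\prod_{i=1}^m\mathcal P(s_i,a_i,s'_i)$ and $L^m(\mathbf s)=(L(s_1),\dots,L(s_m))$. Let $\varphi$ be an LTL formula (built with $\wedge,\neg,\mathsf X,\mathsf U$) over the atomic propositions $p_j$ ($p\in AP$, $1\le j\le m$), interpreted on infinite sequences $w_0w_1\dots$ over $(2^{AP})^m$, where $p_j$ holds iff $p\in (w_0)_j$.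 Let $\mathcal A=(Q,(2^{AP})^m,\delta,q_0,\mathit{Acc})$ be a deterministic Rabin automaton with finite $Q$ that accepts exactly the sequences satisfying $\varphi$; here a state sequence $\rho$ is accepting if for some pair $(L,K)\in\mathit{Acc}$ it is in $L$ only finitely often and in $K$ infinitely often. The synchronised product $\mathcal D$ is the Markov decision process with states $S^m\times Q$, actions $\mathit{Act}^m\times\{\alpha\}$ and labels $L_{\mathcal D}(\mathbf s,q)=L^m(\mathbf s)$, where $$\mathcal P_{\mathcal D}\bigl((\mathbf s,q),(\mathbf a,\alpha),(\mathbf s',q')\bigr)=\begin{cases}\mathcal P^m(\mathbf s,\mathbf a,\mathbf s') & \text{if } q'=\delta(q,L^m(\mathbf s')),\\ 0&\text{otherwise.}\end{cases}$$ For a policy $\sigma$ of $M^m$ let $\sigma'$ be the policy of $\mathcal D$ given by $\sigma'(\pi)=(\sigma(\bar\pi),\alpha)$, where $\bar\pi$ is the projection of the path $\pi$ to $M^m$. If $\sigma$ is memoryless, then so is $\sigma'$, and the success set $U_{\mathcal A}\subseteq S^m\times Q$ is the union of all bottom strongly connected components $T$ of the Markov chain that $\sigma'$ induces on $S^m\times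 Q$ for which there is a pair $(L,K)\in\mathit{Acc}$ with $T\cap(S^m\times L)=\emptyset$ and $T\cap (S^m\times K)\ne\emptyset$. **Theorem.** Let $\mathbf s\in S^m$ and let $\sigma$ be a policy of $M^m$. 1. The probability $\mathbb P_{(M^m)^\sigma}(\mathbf s\models\varphi)$ that the label sequence of $(M^m)^\sigma$ started in $\mathbf s$ satisfies $\varphi$ equals the probability that, in $\mathcal D^{\sigma'}$ started in $(\mathbf s,\delta(q_0,L^m(\mathbf s)))$, the sequence of $Q$-components of the visited states is accepting. 2. If $\sigma$ is memoryless, then $\mathbb P_{(M^m)^\sigma}(\mathbf s\models\varphi)$ equals the probability that $\mathcal D^{\sigma'}$ started in $(\mathbf s,\delta(q_0,L^m(\mathbf s)))$ reaches $U_{\mathcal A}$. -/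

import Mathlib

open MeasureTheory ProbabilityTheory
open scoped ENNReal

noncomputable section

/-- A labelled Markov chain with state set `X`. -/
structure MC (X Λ : Type*) where
  P : X → PMF X
  L : X → Λ

namespace MC

variable {X Λ : Type*}

/-- The σ-algebra on infinite sequences that is generated by the cylinder sets. -/
abbrev seqSpace (X : Type*) : MeasurableSpace (ℕ → X) :=
  @MeasurableSpace.pi ℕ (fun _ => X) (fun _ => ⊤)

/-- The transition kernel at time `n`: the next state has law `P (x n)`. -/
def stepKernel (C : MC X Λ) (n : ℕ) :
    @Kernel ((i : Finset.Iic n) → X) X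
      (@MeasurableSpace.pi (Finset.Iic n) (fun _ => X) (fun _ => ⊤)) ⊤ :=
  letI : MeasurableSpace X := ⊤
  Kernel.comap (⟨fun x => (C.P x).toMeasure, measurable_from_top⟩ : Kernel X X)
    (fun x : (i : Finset.Iic n) → X => x ⟨n, Finset.mem_Iic.2 le_rfl⟩) (measurable_pi_apply _)

/-- The law of the infinite sequence of states visited by the chain `C` started in `x`. -/
def pathMeasure (C : MC X Λ) (x : X) : @Measure (ℕ → X) (seqSpace X) :=
  letI : MeasurableSpace X := ⊤
  have : ∀ n, IsMarkovKernel (C.stepKernel n) := fun n => by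
    have : IsMarkovKernel
        (⟨fun x => (C.P x).toMeasure, measurable_from_top⟩ : Kernel X X) :=
      ⟨fun x => PMF.toMeasure.isProbabilityMeasure (C.P x)⟩
    unfold stepKernel
    infer_instance
  Kernel.traj (X := fun _ => X) (fun n => C.stepKernel n) 0 (fun _ => x)

/-- The probability that the chain started in `x` produces a state sequence in `E`. -/
def pr (C : MC X Λ) (x : X) (E : Set (ℕ → X)) : ℝ≥0∞ := C.pathMeasure x E

/-- The probability of reaching some state of `T` from `x`. -/
def reach (C : MC X Λ) (x : X) (T : Set X) : ℝ≥0∞ := C.pr x {ω | ∃ n, ω n ∈ T}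

/-- `y` can be reached from `x` (in zero or more steps) with positive probability. -/
def Reaches (C : MC X Λ) : X → X → Prop := Relation.ReflTransGen fun x y => 0 < C.P x y

/-- `T` is a bottom strongly connected component of the transition graph. -/
def IsBSCC (C : MC X Λ) (T : Set X) : Prop :=
  T.Nonempty ∧ (∀ x ∈ T, ∀ y ∈ T, C.Reaches x y) ∧ ∀ x ∈ T, ∀ y, C.Reaches x y → y ∈ T

end MC

/-- A Markov decision process with states `S`, actions `Act` and labels in `Λ`
(`Λ = Set AP` for a process over atomic propositions `AP`). -/
structure MDP (S Act Λ : Type*) where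
  P : S → Act → PMF S
  L : S → Λ

namespace MDP

variable {S Act Λ : Type*}

/-- Finite paths `s⁰a⁰s¹a¹…sⁿ` (all transitions of positive probability) with last state `sⁿ`
given as index. -/
inductive PathTo (M : MDP S Act Λ) : S → Type _
  | single (s : S) : PathTo M s
  | snoc {s : S} (π : PathTo M s) (a : Act) (s' : S) (h : 0 < M.P s a s') : PathTo M s'

/-- The set of all finite paths. -/
def Path (M : MDP S Act Λ) := Σ s : S, M.PathTo s

namespace Path

variable {M : MDP S Act Λ}

/-- The path consisting of one state. -/
def single (M : MDP S Act Λ) (s : S) : M.Path := ⟨s, .single s⟩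

/-- The last state of a path. -/
def last (π : M.Path) : S := π.1

/-- The path `π a s'`. -/
def snoc (π : M.Path) (a : Act) (s' : S) (h : 0 < M.P π.last a s') : M.Path :=
  ⟨s', .snoc π.2 a s' h⟩

end Path

/-- Deterministic, history-dependent policies. -/
abbrev Policy (M : MDP S Act Λ) := M.Path → Act

variable {M : MDP S Act Λ}

/-- The selected action depends only on the last state of the path. -/
def Policy.IsMemoryless (σ : M.Policy) : Prop :=
  ∀ π π' : M.Path, π.last = π'.last → σ π = σ π'

/-- The induced Markov chain `M^σ`. Its states are the finite paths of `M`; from `π` it moves to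
`π a s'` with `a = σ π`, with probability `P (last π) a s'`. -/
def induced (M : MDP S Act Λ) (σ : M.Policy) : MC M.Path Λ where
  P π := (M.P π.last (σ π)).bindOnSupport fun s' h =>
    PMF.pure (π.snoc (σ π) s' ((M.P π.last (σ π)).apply_pos_iff s' |>.2 h))
  L π := M.L π.last

/-- The probability of reaching, from state `s` and under policy `σ`, some state of `T`. -/
def reach (M : MDP S Act Λ) (σ : M.Policy) (s : S) (T : Set S) : ℝ≥0∞ :=
  (M.induced σ).reach (Path.single M s) {π | π.last ∈ T}

/-- The Markov chain on the states of `M` induced by a memoryless policy, that is, `M^σ` with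
paths that have the same last state identified. (Meaningful for memoryless `σ` only.) -/
def stateChain (M : MDP S Act Λ) (σ : M.Policy) : MC S Λ where
  P s := M.P s (σ (Path.single M s))
  L := M.L

/-- The `m`-self-composition `M^m`. -/
def selfComp [Fintype S] (M : MDP S Act Λ) (m : ℕ) :
    MDP (Fin m → S) (Fin m → Act) (Fin m → Λ) where
  P s a := PMF.ofFintype (fun s' => ∏ i, M.P (s i) (a i) (s' i)) (by
    classical
    rw [← Fintype.prod_sum fun i x => M.P (s i) (a i) x]
    exact Finset.prod_eq_one fun i _ => by
      simpa [tsum_fintype] using (M.P (s i) (a i)).tsum_coe)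
  L s i := M.L (s i)

end MDP

/-- LTL formulae over the propositions `p_j`, for `p ∈ AP` and an agent index `j < m`. -/
inductive LTL (AP : Type*) (m : ℕ)
  | atom (p : AP) (j : Fin m)
  | and (φ ψ : LTL AP m)
  | neg (φ : LTL AP m)
  | next (φ : LTL AP m)
  | until (φ ψ : LTL AP m)

/-- `φ.Sat w`: the infinite trace `w` of `m`-tuples of labels satisfies `φ`. -/
def LTL.Sat {AP : Type*} {m : ℕ} : LTL AP m → (ℕ → Fin m → Set AP) → Prop
  | .atom p j, w => p ∈ w 0 j
  | .and φ ψ, w => φ.Sat w ∧ ψ.Sat w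
  | .neg φ, w => ¬ φ.Sat w
  | .next φ, w => φ.Sat fun n => w (n + 1)
  | .until φ ψ, w => ∃ j, ψ.Sat (fun n => w (n + j)) ∧ ∀ i < j, φ.Sat fun n => w (n + i)

/-- Deterministic Rabin automata with states `Q` and alphabet `A`. -/
structure DRA (Q A : Type*) where
  δ : Q → A → Q
  q₀ : Q
  Acc : Set (Set Q × Set Q)

namespace DRA

variable {Q A : Type*}

/-- The run on the word `w`. -/
def run (R : DRA Q A) (w : ℕ → A) : ℕ → Q
  | 0 => R.q₀
  | n + 1 => R.δ (R.run w n) (w n)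

/-- The Rabin condition: for some pair `(L, K)`, the set `L` is visited finitely often and the
set `K` infinitely often. -/
def IsAccepting (R : DRA Q A) (ρ : ℕ → Q) : Prop :=
  ∃ LK ∈ R.Acc, {n | ρ n ∈ LK.1}.Finite ∧ {n | ρ n ∈ LK.2}.Infinite

def Accepts (R : DRA Q A) (w : ℕ → A) : Prop := R.IsAccepting (R.run w)

end DRA

namespace MDP

variable {S Act Λ Q : Type*}

/-- The synchronised product of `N` with a Rabin automaton over the labels of `N`. The automaton
reads the label of the state that is entered. The second action component is the fresh action
`α`, here the only element of `Unit`. -/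
def syncProd (N : MDP S Act Λ) (R : DRA Q Λ) : MDP (S × Q) (Act × Unit) Λ where
  P x a := (N.P x.1 a.1).map fun s' => (s', R.δ x.2 (N.L s'))
  L x := N.L x.1

/-- The transition probabilities of the synchronised product. -/
theorem syncProd_P_apply [DecidableEq Q] (N : MDP S Act Λ) (R : DRA Q Λ) (s s' : S) (q q' : Q)
    (a : Act) (u : Unit) :
    (N.syncProd R).P (s, q) (a, u) (s', q') =
      if R.δ q (N.L s') = q' then N.P s a s' else 0 := by
  classical
  simp only [syncProd, PMF.map_apply]
  rw [tsum_eq_single s']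
  · simp [eq_comm]
  · intro t ht
    rw [if_neg]
    intro h
    exact ht (congrArg Prod.fst h).symm

theorem pos_of_syncProd {N : MDP S Act Λ} {R : DRA Q Λ} {x y : S × Q} {a : Act × Unit}
    (h : 0 < (N.syncProd R).P x a y) : 0 < N.P x.1 a.1 y.1 := by
  classical
  obtain ⟨s, q⟩ := x
  obtain ⟨s', q'⟩ := y
  obtain ⟨a, u⟩ := a
  rw [syncProd_P_apply] at h
  split_ifs at h
  · exact h
  · exact absurd h (lt_irrefl _)

/-- The projection of a path of the product to the path of `N` in it. -/
def PathTo.proj {N : MDP S Act Λ} {R : DRA Q Λ} :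
    {x : S × Q} → (N.syncProd R).PathTo x → N.PathTo x.1
  | _, .single x => .single x.1
  | _, .snoc π a y h => .snoc π.proj a.1 y.1 (pos_of_syncProd h)

def Path.proj {N : MDP S Act Λ} {R : DRA Q Λ} (π : (N.syncProd R).Path) : N.Path :=
  ⟨π.1.1, π.2.proj⟩

/-- The lifted policy `σ' = (σ, α)` on the product. -/
def Policy.lift {N : MDP S Act Λ} (σ : N.Policy) (R : DRA Q Λ) : (N.syncProd R).Policy :=
  fun π => (σ π.proj, ())

/-- The success set: the union of all bottom strongly connected components of the chain induced
on the product by (the memoryless policy) `τ` that are accepting, that is, that avoid `L` and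
meet `K` for some Rabin pair `(L, K)`. -/
def successSet (N : MDP S Act Λ) (R : DRA Q Λ) (τ : (N.syncProd R).Policy) : Set (S × Q) :=
  ⋃₀ {T | ((N.syncProd R).stateChain τ).IsBSCC T ∧
    ∃ LK ∈ R.Acc, (∀ x ∈ T, x.2 ∉ LK.1) ∧ ∃ x ∈ T, x.2 ∈ LK.2}

/-- The probability that the label trace of the `σ`-induced chain on `M^m`, started in `s`,
satisfies `φ`. -/
def prLTL {AP : Type*} {m : ℕ} (N : MDP S Act (Fin m → Set AP)) (σ : N.Policy) (s : S)
    (φ : LTL AP m) : ℝ≥0∞ :=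
  (N.induced σ).pr (Path.single N s) {ω | φ.Sat fun n => (N.induced σ).L (ω n)}

end MDP

end

/-! ### Path measures: uniqueness, images under maps of chains, almost sure invariants. -/

namespace MC

variable {X Y Λ Λ' : Type*}

/-! The automaton is deterministic, so the product adds no randomness: projecting its paths sends
its path measure to that of the original induced chain (`pathMeasure_map`,
`induced_lift_P_map_proj`). Almost surely the `Q`-components are the automaton's run on the label
trace, one step ahead, and the Rabin condition ignores the shift (`ae_isAccepting_iff_accepts`).
This gives the first claim.

For a memoryless policy, taking last states maps the chain on paths to a finite chain on `S × Q`.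
There, by Lévy's conditional Borel–Cantelli lemma, the states visited infinitely often almost surely
form a bottom component (`ae_isBSCC`). A path that enters a bottom component stays in it and visits
all of it infinitely often, so acceptance can be read off the component (`ae_isAccepting_iff`). -/

theorem isMarkovKernel_stepKernel (C : MC X Λ) (n : ℕ) :
    letI : MeasurableSpace X := ⊤
    IsMarkovKernel (C.stepKernel n) := by
  let : MeasurableSpace X := ⊤
  have : IsMarkovKernel (⟨fun x => (C.P x).toMeasure, measurable_from_top⟩ : Kernel X X) :=
    ⟨fun x => PMF.toMeasure.isProbabilityMeasure (C.P x)⟩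
  unfold stepKernel
  infer_instance

theorem stepKernel_apply (C : MC X Λ) (n : ℕ) (u : Finset.Iic n → X) :
    letI : MeasurableSpace X := ⊤
    C.stepKernel n u = (C.P (u ⟨n, Finset.mem_Iic.2 le_rfl⟩)).toMeasure := rfl

theorem isProbabilityMeasure_pathMeasure (C : MC X Λ) (x : X) :
    letI : MeasurableSpace X := ⊤
    IsProbabilityMeasure (C.pathMeasure x) := by
  let : MeasurableSpace X := ⊤
  have := C.isMarkovKernel_stepKernel
  unfold pathMeasure
  infer_instance

theorem pathMeasure_map_zero (C : MC X Λ) (x : X) :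
    letI : MeasurableSpace X := ⊤
    (C.pathMeasure x).map (Preorder.frestrictLe 0) = Measure.dirac fun _ => x := by
  let : MeasurableSpace X := ⊤
  have := C.isMarkovKernel_stepKernel
  unfold pathMeasure
  rw [Kernel.traj_map_frestrictLe_apply, Kernel.partialTraj_self, Kernel.id_apply]

theorem pathMeasure_map_succ (C : MC X Λ) (x : X) (n : ℕ) :
    letI : MeasurableSpace X := ⊤
    (C.pathMeasure x).map (fun ω => (Preorder.frestrictLe n ω, ω (n + 1))) =
      (C.pathMeasure x).map (Preorder.frestrictLe n) ⊗ₘ C.stepKernel n := by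
  let : MeasurableSpace X := ⊤
  have := C.isMarkovKernel_stepKernel
  unfold pathMeasure
  rw [Kernel.traj_map_frestrictLe_apply]
  exact (Kernel.partialTraj_compProd_eq_map_traj (X := fun _ => X) (κ := fun n => C.stepKernel n)
    (Nat.zero_le n) (x₀ := fun _ => x)).symm

/-- The path measure is determined by the initial state and the one-step transition law. -/
theorem eq_pathMeasure (C : MC X Λ) (x : X) :
    letI : MeasurableSpace X := ⊤
    ∀ μ : Measure (ℕ → X),
    (μ.map (Preorder.frestrictLe 0) = Measure.dirac fun _ => x) →
    (∀ n, μ.map (fun ω => (Preorder.frestrictLe n ω, ω (n + 1))) =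
      μ.map (Preorder.frestrictLe n) ⊗ₘ C.stepKernel n) →
    μ = C.pathMeasure x := by
  let : MeasurableSpace X := ⊤
  intro μ h0 hs
  have := C.isMarkovKernel_stepKernel
  have key : ∀ n, μ.map (Preorder.frestrictLe n) =
      (C.pathMeasure x).map (Preorder.frestrictLe n) := by
    intro n
    induction n with
    | zero => rw [h0, pathMeasure_map_zero]
    | succ n ih =>
      -- Gluing a history to the next state: the law of the history up to `n + 1` is the image under
      -- `g` of the joint law fixed by `hs`.
      let g : (Finset.Iic n → X) × X → (Finset.Iic (n + 1) → X) := fun p i =>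
        if h : i.1 ≤ n then p.1 ⟨i.1, Finset.mem_Iic.2 h⟩ else p.2
      have hg : Measurable g := by
        refine measurable_pi_iff.2 fun i => ?_
        by_cases h : i.1 ≤ n
        · simp only [g, h, dif_pos]; fun_prop
        · simp only [g, h, dif_neg, not_false_eq_true]; fun_prop
      have hgr : (Preorder.frestrictLe (n + 1) : (ℕ → X) → _) =
          g ∘ fun ω => (Preorder.frestrictLe n ω, ω (n + 1)) := by
        ext ω i
        by_cases h : i.1 ≤ n
        · simp [g, h]
        · have : i.1 = n + 1 := by have := Finset.mem_Iic.1 i.2; omega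
          simp [g, this]
      rw [hgr, ← Measure.map_map hg (by fun_prop), ← Measure.map_map hg (by fun_prop), hs, ih,
        pathMeasure_map_succ]
  have hproj := Kernel.isProjectiveMeasureFamily_partialTraj (X := fun _ => X)
    (fun n => C.stepKernel n) (a := 0) (fun _ => x)
  have hlim := Kernel.isProjectiveLimit_trajFun (X := fun _ => X)
    (fun n => C.stepKernel n) 0 (fun _ => x)
  have hP : ∀ n, IsProbabilityMeasure
      (Kernel.partialTraj (X := fun _ => X) (fun n => C.stepKernel n) 0 n fun _ => x) :=
    fun n => inferInstance
  have : ∀ I, IsFiniteMeasure (inducedFamily (X := fun _ => X) (fun n =>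
      Kernel.partialTraj (X := fun _ => X) (fun n => C.stepKernel n) 0 n fun _ => x) I) :=
    fun I => inferInstance
  -- A projective limit of finite measures is unique, so the laws of the histories determine `μ`.
  refine ((isProjectiveLimit_nat_iff hproj μ).2 fun n => ?_).unique hlim
  rw [key]
  exact (isProjectiveLimit_nat_iff hproj _).1 hlim n

/-- Applying a function to every entry of a sequence is measurable. -/
theorem measurable_comp_seq (f : X → Y) :
    Measurable[seqSpace X, seqSpace Y] fun (ω : ℕ → X) n => f (ω n) := by
  let : MeasurableSpace X := ⊤
  let : MeasurableSpace Y := ⊤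
  have hf : Measurable f := measurable_from_top
  fun_prop

/-- A map that is compatible with the transition probabilities maps path measures to path
measures. -/
theorem pathMeasure_map (C : MC X Λ) (D : MC Y Λ') (f : X → Y)
    (hf : ∀ x, (C.P x).map f = D.P (f x)) (x : X) :
    letI : MeasurableSpace X := ⊤
    letI : MeasurableSpace Y := ⊤
    (C.pathMeasure x).map (fun ω n => f (ω n)) = D.pathMeasure (f x) := by
  let : MeasurableSpace X := ⊤
  let : MeasurableSpace Y := ⊤
  have := C.isMarkovKernel_stepKernel
  have := D.isMarkovKernel_stepKernel
  have := C.isProbabilityMeasure_pathMeasure x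
  have hfm : Measurable f := measurable_from_top
  have hF : Measurable fun (ω : ℕ → X) n => f (ω n) := measurable_comp_seq f
  have hFn : ∀ n : ℕ, Measurable fun (ω : Finset.Iic n → X) i => f (ω i) := fun n => by fun_prop
  have := Measure.isProbabilityMeasure_map (μ := C.pathMeasure x) hF.aemeasurable
  have hcomm : ∀ n, ((C.pathMeasure x).map fun ω n => f (ω n)).map
      (Preorder.frestrictLe (π := fun _ => Y) n) =
      ((C.pathMeasure x).map (Preorder.frestrictLe (π := fun _ => X) n)).map
        fun ω i => f (ω i) := fun n => by
    rw [Measure.map_map (by fun_prop) hF, Measure.map_map (hFn n) (by fun_prop)]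
    rfl
  refine D.eq_pathMeasure (f x) _ ?_ fun n => ?_
  · rw [hcomm, pathMeasure_map_zero]
    exact Measure.map_dirac' (hFn 0) _
  · rw [hcomm]
    have hpair : Measurable fun p : (Finset.Iic n → X) × X =>
      ((fun i => f (p.1 i) : Finset.Iic n → Y), f p.2) := by fun_prop
    have : ((C.pathMeasure x).map fun ω n => f (ω n)).map
          (fun ω => (Preorder.frestrictLe n ω, ω (n + 1))) =
        ((C.pathMeasure x).map fun ω => (Preorder.frestrictLe n ω, ω (n + 1))).map
          fun p : (Finset.Iic n → X) × X =>
            ((fun i => f (p.1 i) : Finset.Iic n → Y), f p.2) := by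
      rw [Measure.map_map (by fun_prop) hF, Measure.map_map hpair (by fun_prop)]
      rfl
    rw [this, pathMeasure_map_succ]
    have := Measure.isProbabilityMeasure_map (μ := C.pathMeasure x)
      (Preorder.measurable_frestrictLe (X := fun _ => X) n).aemeasurable
    -- Rectangles suffice; on them both sides integrate the probability of stepping into `t`, and
    -- `hf` matches the integrands.
    refine Measure.ext_prod fun {s t} hs ht => ?_
    rw [Measure.map_apply hpair (hs.prod ht), Measure.compProd_apply_prod hs ht,
      setLIntegral_map hs (Kernel.measurable_coe _ ht) (hFn n)]
    refine (Measure.compProd_apply_prod (hFn n hs) (hfm ht)).trans ?_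
    refine setLIntegral_congr_fun (hFn n hs) fun u _ => ?_
    simp only [stepKernel_apply]
    rw [← hf, PMF.toMeasure_map_apply f _ _ hfm ht]

theorem ae_zero (C : MC X Λ) (x : X) :
    letI : MeasurableSpace X := ⊤
    ∀ᵐ ω ∂C.pathMeasure x, ω 0 = x := by
  let : MeasurableSpace X := ⊤
  have h : ∀ᵐ u ∂(C.pathMeasure x).map (Preorder.frestrictLe 0),
      u ⟨0, Finset.mem_Iic.2 le_rfl⟩ = x := by
    rw [pathMeasure_map_zero, ae_dirac_iff]
    exact measurable_pi_apply (X := fun _ : Finset.Iic 0 => X) _ (measurableSet_singleton x)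
  exact ae_of_ae_map (by fun_prop) h

/-- A relation that holds along every transition of positive probability almost surely holds
along the whole path. -/
theorem ae_forall_rel {Z : Type*} [Countable Z] (C : MC X Λ) (x : X) (f : X → Z)
    (r : Z → Z → Prop) (hr : ∀ y y', 0 < C.P y y' → r (f y) (f y')) :
    letI : MeasurableSpace X := ⊤
    ∀ᵐ ω ∂C.pathMeasure x, ∀ n, r (f (ω n)) (f (ω (n + 1))) := by
  let : MeasurableSpace X := ⊤
  let : MeasurableSpace Z := ⊤
  have := C.isMarkovKernel_stepKernel
  have := C.isProbabilityMeasure_pathMeasure x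
  have hfm : Measurable f := measurable_from_top
  refine ae_all_iff.2 fun n => ?_
  have := Measure.isProbabilityMeasure_map (μ := C.pathMeasure x)
    (Preorder.measurable_frestrictLe (X := fun _ => X) n).aemeasurable
  have h : ∀ᵐ p ∂(C.pathMeasure x).map (fun ω => (Preorder.frestrictLe n ω, ω (n + 1))),
      r (f (p.1 ⟨n, Finset.mem_Iic.2 le_rfl⟩)) (f p.2) := by
    rw [pathMeasure_map_succ]
    refine Measure.ae_compProd_of_ae_ae ?_ (ae_of_all _ fun u => ?_)
    · have : Measurable fun p : (Finset.Iic n → X) × X =>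
          (f (p.1 ⟨n, Finset.mem_Iic.2 le_rfl⟩), f p.2) := by fun_prop
      -- Countability of `Z` makes `r` measurable in the product σ-algebra; the state space `X`
      -- itself may be uncountable.
      exact this (Set.to_countable {q : Z × Z | r q.1 q.2}).measurableSet
    · rw [stepKernel_apply, ae_iff, PMF.toMeasure_apply_eq_zero_iff _ (by trivial)]
      refine Set.disjoint_left.2 fun y hy hy' => hy' (hr _ _ ?_)
      exact (PMF.apply_pos_iff _ _).2 hy
  exact ae_of_ae_map (by fun_prop) h

end MC

/-! ### Recurrence and bottom components in finite chains. -/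

namespace MC

variable {X Λ : Type*}

/-- The Markov property, in the form that the conditional Borel–Cantelli lemma consumes. -/
theorem condExp_indicator_succ (C : MC X Λ) (x b : X) (n : ℕ) :
    letI : MeasurableSpace X := ⊤
    (C.pathMeasure x)[{ω : ℕ → X | ω (n + 1) = b}.indicator (fun _ => (1 : ℝ)) |
      Filtration.piLE (X := fun _ => X) n] =ᵐ[C.pathMeasure x]
        fun ω => (C.P (ω n) b).toReal := by
  let : MeasurableSpace X := ⊤
  have := C.isMarkovKernel_stepKernel
  have := C.isProbabilityMeasure_pathMeasure x
  have hm : MeasurableSet {ω : ℕ → X | ω (n + 1) = b} :=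
    measurable_pi_apply (X := fun _ : ℕ => X) (n + 1) (measurableSet_singleton b)
  have hi : Integrable ({ω : ℕ → X | ω (n + 1) = b}.indicator fun _ => (1 : ℝ))
      (C.pathMeasure x) := (integrable_const 1).indicator hm
  have h := Kernel.condExp_traj (X := fun _ => X) (κ := fun n => C.stepKernel n)
    (x₀ := fun _ => x) (Nat.zero_le n) hi
  refine h.trans (ae_of_all _ fun ω => ?_)
  simp only
  rw [integral_indicator_const _ hm, smul_eq_mul, mul_one, measureReal_def]
  congr 1
  have h2 := congrArg (fun κ => κ (Preorder.frestrictLe n ω) {b})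
    (Kernel.map_traj_succ_self (X := fun _ => X) (κ := fun n => C.stepKernel n) (a := n))
  rw [Kernel.map_apply' _ (by fun_prop) _ (measurableSet_singleton b)] at h2
  refine h2.trans ?_
  rw [stepKernel_apply, PMF.toMeasure_apply_singleton _ _ (measurableSet_singleton b)]
  rfl

/-- Almost surely, a successor of a state that is visited infinitely often is itself visited
infinitely often. -/
theorem ae_infinite_of_pos (C : MC X Λ) (x : X) {a b : X} (hab : 0 < C.P a b) :
    letI : MeasurableSpace X := ⊤
    ∀ᵐ ω ∂C.pathMeasure x, {n | ω n = a}.Infinite → {n | ω n = b}.Infinite := by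
  let : MeasurableSpace X := ⊤
  have := C.isProbabilityMeasure_pathMeasure x
  have hle : ∀ (c : X) (k n : ℕ), k ≤ n →
      MeasurableSet[Filtration.piLE (X := fun _ => X) n] {ω : ℕ → X | ω k = c} := by
    intro c k n hkn
    exact ⟨{u | u ⟨k, hkn⟩ = c},
      measurable_pi_apply (X := fun _ : Set.Iic n => X) _ (measurableSet_singleton c), rfl⟩
  -- The step from `a` to `b` is completed at time `n`. The truncated `0 - 1` affects only `s 0`,
  -- which is irrelevant to the limsup.
  let s : ℕ → Set (ℕ → X) := fun n => {ω | ω (n - 1) = a} ∩ {ω | ω n = b}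
  have hs : ∀ n, MeasurableSet[Filtration.piLE (X := fun _ => X) n] (s n) := fun n =>
    (hle a _ _ (Nat.sub_le _ _)).inter (hle b _ _ le_rfl)
  have hce : ∀ᵐ ω ∂C.pathMeasure x, ∀ k,
      ((C.pathMeasure x)[(s (k + 1)).indicator (1 : (ℕ → X) → ℝ) |
        Filtration.piLE (X := fun _ => X) k]) ω =
      {ω : ℕ → X | ω k = a}.indicator (fun _ => (C.P a b).toReal) ω := by
    refine ae_all_iff.2 fun k => ?_
    have hb : MeasurableSet {ω : ℕ → X | ω (k + 1) = b} :=
      measurable_pi_apply (X := fun _ : ℕ => X) (k + 1) (measurableSet_singleton b)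
    have h1 : (s (k + 1)).indicator (1 : (ℕ → X) → ℝ) = {ω : ℕ → X | ω k = a}.indicator
        ({ω : ℕ → X | ω (k + 1) = b}.indicator fun _ => 1) := by
      rw [Set.indicator_indicator]; rfl
    rw [h1]
    have h2 := condExp_indicator (μ := C.pathMeasure x)
      (m := Filtration.piLE (X := fun _ => X) k)
      (f := {ω : ℕ → X | ω (k + 1) = b}.indicator fun _ => (1 : ℝ))
      ((integrable_const 1).indicator hb) (hle a k k le_rfl)
    filter_upwards [h2, C.condExp_indicator_succ x b k] with ω h2 h3
    rw [h2]
    by_cases h : ω k = a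
    · rw [Set.indicator_of_mem (by exact h), Set.indicator_of_mem (by exact h), h3, h]
    · rw [Set.indicator_of_notMem (by exact h), Set.indicator_of_notMem (by exact h)]
  have hp : 0 < (C.P a b).toReal := ENNReal.toReal_pos hab.ne' ((C.P a).apply_ne_top b)
  -- The conditional probabilities sum to `C.P a b` times the number of visits to `a`, which
  -- diverges; hence infinitely many steps go from `a` to `b`.
  filter_upwards [ae_mem_limsup_atTop_iff (C.pathMeasure x) hs, hce] with ω h1 h2 ha
  have hlim : ω ∈ Filter.limsup (fun k => {ω : ℕ → X | ω k = a}) Filter.atTop :=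
    Filter.mem_limsup_iff_frequently_mem.2 (Nat.frequently_atTop_iff_infinite.2 ha)
  rw [Set.limsup_eq_tendsto_sum_indicator_atTop hp] at hlim
  have hmem := h1.2 (by simp only [h2]; exact hlim)
  refine Nat.frequently_atTop_iff_infinite.1
    ((Filter.mem_limsup_iff_frequently_mem.1 hmem).mono fun n hn => hn.2)

theorem reaches_of_le (C : MC X Λ) {ω : ℕ → X} (h : ∀ n, 0 < C.P (ω n) (ω (n + 1))) {k n : ℕ}
    (hkn : k ≤ n) : C.Reaches (ω k) (ω n) := by
  induction n, hkn using Nat.le_induction with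
  | base => exact .refl
  | succ n _ ih => exact ih.tail (h n)

/-- In a finite chain, the states that are visited infinitely often almost surely form a bottom
strongly connected component. -/
theorem ae_isBSCC [Finite X] (C : MC X Λ) (x : X) :
    letI : MeasurableSpace X := ⊤
    ∀ᵐ ω ∂C.pathMeasure x, C.IsBSCC {y | {n | ω n = y}.Infinite} := by
  let : MeasurableSpace X := ⊤
  have h : ∀ᵐ ω ∂C.pathMeasure x, ∀ a b : X, 0 < C.P a b →
      {n | ω n = a}.Infinite → {n | ω n = b}.Infinite := by
    refine ae_all_iff.2 fun a => ae_all_iff.2 fun b => ?_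
    by_cases hab : 0 < C.P a b
    · filter_upwards [C.ae_infinite_of_pos x hab] with ω h _ using h
    · exact ae_of_all _ fun ω h => absurd h hab
  filter_upwards [h, C.ae_forall_rel x id (fun y y' => 0 < C.P y y') fun _ _ h => h]
    with ω h1 h2
  refine ⟨?_, fun y hy z hz => ?_, fun y hy z hyz => ?_⟩
  · obtain ⟨y, hy⟩ := Finite.exists_infinite_fiber ω
    exact ⟨y, Set.infinite_coe_iff.1 hy⟩
  · obtain ⟨k, hk⟩ := hy.nonempty
    obtain ⟨n, hn, hkn⟩ := hz.exists_gt k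
    rw [← show ω k = y from hk, ← show ω n = z from hn]
    exact C.reaches_of_le h2 hkn.le
  · induction hyz with
    | refl => exact hy
    | tail _ hbc ih => exact h1 _ _ hbc ih

/-- In a finite chain over states with an automaton component, the Rabin condition almost surely
holds iff an accepting bottom strongly connected component is reached. -/
theorem ae_isAccepting_iff {S Q A : Type*} [Finite S] [Finite Q] (C : MC (S × Q) Λ)
    (R : DRA Q A) (x : S × Q) :
    letI : MeasurableSpace (S × Q) := ⊤
    ∀ᵐ ω ∂C.pathMeasure x, (R.IsAccepting fun n => (ω n).2) ↔
      ∃ n, ω n ∈ ⋃₀ {T | C.IsBSCC T ∧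
        ∃ LK ∈ R.Acc, (∀ x ∈ T, x.2 ∉ LK.1) ∧ ∃ x ∈ T, x.2 ∈ LK.2} := by
  let : MeasurableSpace (S × Q) := ⊤
  filter_upwards [C.ae_isBSCC x, C.ae_forall_rel x id (fun y y' => 0 < C.P y y') fun _ _ h => h]
    with ω hI hω
  constructor
  · rintro ⟨LK, hLK, hL, hK⟩
    obtain ⟨y, hy⟩ := hI.1
    obtain ⟨n, rfl⟩ := hy.nonempty
    -- The component is the set of infinitely visited states itself.
    refine ⟨n, _, ⟨hI, LK, hLK, fun z hz hzL => hz (hL.subset ?_), ?_⟩, hy⟩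
    · rintro k rfl
      exact hzL
    · by_contra! hcon
      -- Otherwise the visits to `K` would be a finite union of finite sets of times.
      refine hK (((Set.toFinite {z : S × Q | z.2 ∈ LK.2}).biUnion
        (t := fun z => {n | ω n = z}) fun z hz => ?_).subset fun k hk => ?_)
      · by_contra hinf
        exact hcon z hinf hz
      · exact Set.mem_biUnion (x := ω k) hk rfl
  · rintro ⟨n, T, ⟨hT, LK, hLK, hL, z, hz, hzK⟩, hn⟩
    have hmem : ∀ k, n ≤ k → ω k ∈ T := fun k hk => hT.2.2 _ hn _ (C.reaches_of_le hω hk)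
    obtain ⟨y, hy⟩ := hI.1
    obtain ⟨k, rfl, hk⟩ := Set.Infinite.exists_gt hy n
    -- The recurrent state `ω k` lies in `T`, so it reaches `z`, and the recurrent set is closed
    -- under reachability.
    have hzI : {n | ω n = z}.Infinite :=
      hI.2.2 _ hy z (hT.2.1 _ (hmem k hk.le) z hz)
    refine ⟨LK, hLK, (Set.finite_lt_nat n).subset fun k hk => ?_, hzI.mono ?_⟩
    · by_contra hlt
      exact hL _ (hmem k (not_lt.1 hlt)) hk
    · rintro k rfl
      exact hzK

end MC

/-! ### Shift invariance of acceptance and measurability of LTL events. -/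

namespace DRA

variable {Q A : Type*}

theorem isAccepting_shift (R : DRA Q A) (ρ : ℕ → Q) :
    R.IsAccepting (fun n => ρ (n + 1)) ↔ R.IsAccepting ρ := by
  have h : ∀ B : Set Q, {n | ρ (n + 1) ∈ B}.Infinite ↔ {n | ρ n ∈ B}.Infinite := fun B => by
    rw [← Nat.frequently_atTop_iff_infinite, ← Nat.frequently_atTop_iff_infinite]
    conv_rhs => rw [← Filter.map_add_atTop_eq_nat 1]
    exact Filter.frequently_map.symm
  simp only [IsAccepting, h, ← Set.not_infinite]

end DRA

theorem LTL.measurableSet_setOf_sat {AP : Type*} {m : ℕ} (φ : LTL AP m) :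
    letI : MeasurableSpace (Fin m → Set AP) := ⊤
    MeasurableSet {w : ℕ → Fin m → Set AP | φ.Sat w} := by
  let : MeasurableSpace (Fin m → Set AP) := ⊤
  have shift : ∀ k : ℕ, Measurable fun (w : ℕ → Fin m → Set AP) n => w (n + k) := fun k =>
    measurable_pi_iff.2 fun n => measurable_pi_apply _
  induction φ with
  | atom p j =>
    exact measurable_pi_apply (X := fun _ : ℕ => Fin m → Set AP) 0
      (t := {v | p ∈ v j}) trivial
  | and φ ψ hφ hψ => exact hφ.inter hψ
  | neg φ hφ => exact hφ.compl
  | next φ hφ => exact shift 1 hφ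
  | _ φ ψ hφ hψ =>
    have : {w : ℕ → Fin m → Set AP | (LTL.until φ ψ).Sat w} =
        ⋃ j, {w | ψ.Sat fun n => w (n + j)} ∩
          ⋂ i, ⋂ _ : i < j, {w | φ.Sat fun n => w (n + i)} := by
      ext w; simp [LTL.Sat]
    rw [this]
    exact .iUnion fun j => (shift j hψ).inter (.iInter fun i => .iInter fun _ => shift i hφ)

/-! ### Induced chains, the product, and the two claims. -/

namespace MDP

variable {S Act Λ Q : Type*}

open Classical in
/-- The path `π a s'` with `a = σ π`; the path `s'` if that transition has probability `0`. -/
noncomputable def Path.next {M : MDP S Act Λ} (σ : M.Policy) (π : M.Path) (s' : S) : M.Path :=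
  if h : 0 < M.P π.last (σ π) s' then π.snoc (σ π) s' h else single M s'

theorem Path.last_next {M : MDP S Act Λ} (σ : M.Policy) (π : M.Path) (s' : S) :
    (Path.next σ π s').last = s' := by
  unfold next
  split_ifs <;> rfl

/-- The default branch of `Path.next` lies off the support, so the dependent bind becomes a plain
pushforward, which composes with other maps. -/
theorem induced_P (M : MDP S Act Λ) (σ : M.Policy) (π : M.Path) :
    (M.induced σ).P π = (M.P π.last (σ π)).map (Path.next σ π) := by
  rw [← PMF.bind_pure_comp, ← PMF.bindOnSupport_eq_bind]
  unfold induced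
  simp only
  congr 1
  funext s' h
  rw [Function.comp_apply, Path.next, dif_pos]

theorem induced_P_map_last (M : MDP S Act Λ) (σ : M.Policy) (π : M.Path) :
    ((M.induced σ).P π).map Path.last = M.P π.last (σ π) := by
  rw [induced_P, PMF.map_comp, show Path.last ∘ Path.next σ π = id from
    funext (Path.last_next σ π), PMF.map_id]

theorem pos_of_induced {M : MDP S Act Λ} {σ : M.Policy} {π π' : M.Path}
    (h : 0 < (M.induced σ).P π π') : 0 < M.P π.last (σ π) π'.last := by
  rw [← induced_P_map_last, PMF.apply_pos_iff, PMF.support_map]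
  exact ⟨π', (PMF.apply_pos_iff _ _).1 h, rfl⟩

section Product

variable {N : MDP S Act Λ} {R : DRA Q Λ}

theorem eq_of_syncProd_pos {x y : S × Q} {a : Act × Unit} (h : 0 < (N.syncProd R).P x a y) :
    y.2 = R.δ x.2 (N.L y.1) := by
  rw [PMF.apply_pos_iff, syncProd, PMF.support_map] at h
  obtain ⟨s, -, rfl⟩ := h
  rfl

/-- This is the hypothesis of `MC.pathMeasure_map` for `Path.proj`. It holds because the next
automaton state is a function of the next state of `N`. -/
theorem induced_lift_P_map_proj (σ : N.Policy) (π : (N.syncProd R).Path) :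
    (((N.syncProd R).induced (σ.lift R)).P π).map Path.proj = (N.induced σ).P π.proj := by
  classical
  rw [induced_P, induced_P]
  rw [show (N.syncProd R).P π.last (σ.lift R π) = (N.P π.proj.last (σ π.proj)).map
    fun s => (s, R.δ π.last.2 (N.L s)) from rfl, PMF.map_comp, PMF.map_comp]
  congr 1
  funext s
  -- Both occurrences of `Path.next` thus take the same branch, and projection respects each branch.
  have hiff : 0 < (N.syncProd R).P π.last (σ.lift R π) (s, R.δ π.last.2 (N.L s)) ↔
      0 < N.P π.proj.last (σ π.proj) s := by
    refine ⟨fun h => pos_of_syncProd h, fun h => ?_⟩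
    exact (((syncProd_P_apply N R _ s _ _ _ ()).trans (if_pos rfl)).symm ▸ h :)
  simp only [Function.comp_apply, Path.next]
  by_cases h : 0 < N.P π.proj.last (σ π.proj) s
  · rw [dif_pos h, dif_pos (hiff.2 h)]
    rfl
  · rw [dif_neg h, dif_neg (mt hiff.1 h)]
    rfl

theorem Policy.IsMemoryless.lift {σ : N.Policy} (hσ : σ.IsMemoryless) (R : DRA Q Λ) :
    (σ.lift R).IsMemoryless := fun π π' h =>
  congrArg (·, ()) (hσ π.proj π'.proj (congrArg Prod.fst h))

theorem ae_isAccepting_iff_accepts [Countable S] [Countable Q] (R : DRA Q Λ) (s : S)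
    (σ : N.Policy) :
    letI : MeasurableSpace (N.syncProd R).Path := ⊤
    ∀ᵐ ω ∂((N.syncProd R).induced (σ.lift R)).pathMeasure (.single _ (s, R.δ R.q₀ (N.L s))),
      (R.IsAccepting fun n => (ω n).last.2) ↔ R.Accepts fun n => N.L (ω n).last.1 := by
  let : MeasurableSpace (N.syncProd R).Path := ⊤
  filter_upwards [MC.ae_zero _ _, MC.ae_forall_rel ((N.syncProd R).induced (σ.lift R))
    (.single _ (s, R.δ R.q₀ (N.L s))) Path.last
    (fun y y' => y'.2 = R.δ y.2 (N.L y'.1))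
    fun π π' h => eq_of_syncProd_pos (pos_of_induced h)] with ω h0 h
  -- Index `n + 1`, since the initial product state has already read the label of `s`.
  have hrun : ∀ n, (ω n).last.2 = R.run (fun n => N.L (ω n).last.1) (n + 1) := by
    intro n
    induction n with
    | zero => rw [h0]; simp only [DRA.run, h0]; rfl
    | succ n ih => rw [h, ih]; rfl
  simp only [hrun]
  exact R.isAccepting_shift _

end Product

theorem prLTL_eq_pr_isAccepting {AP : Type*} {m : ℕ} [Countable S] [Countable Q]
    (N : MDP S Act (Fin m → Set AP)) (φ : LTL AP m) (R : DRA Q (Fin m → Set AP))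
    (hR : ∀ w, R.Accepts w ↔ φ.Sat w) (s : S) (σ : N.Policy) :
    N.prLTL σ s φ = ((N.syncProd R).induced (σ.lift R)).pr (.single _ (s, R.δ R.q₀ (N.L s)))
      {ω | R.IsAccepting fun n => (ω n).last.2} := by
  let : MeasurableSpace (N.syncProd R).Path := ⊤
  let : MeasurableSpace N.Path := ⊤
  let : MeasurableSpace (Fin m → Set AP) := ⊤
  have hE : MeasurableSet {ω : ℕ → N.Path | φ.Sat fun n => (N.induced σ).L (ω n)} :=
    MC.measurable_comp_seq (N.induced σ).L
      φ.measurableSet_setOf_sat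
  have hmap := MC.pathMeasure_map _ _ _ (induced_lift_P_map_proj (R := R) σ)
    (.single _ (s, R.δ R.q₀ (N.L s)))
  unfold prLTL MC.pr
  rw [show Path.single N s = (Path.single (N.syncProd R) (s, R.δ R.q₀ (N.L s))).proj from rfl,
    ← hmap, Measure.map_apply (MC.measurable_comp_seq _) hE]
  -- Almost sure equality is enough, so the Rabin event need not be shown measurable.
  refine measure_congr ?_
  filter_upwards [ae_isAccepting_iff_accepts R s σ] with ω hω
  exact propext ((hω.trans (hR _)).symm)

theorem pr_isAccepting_eq_reach [Finite S] [Finite Q] (N : MDP S Act Λ) (R : DRA Q Λ)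
    {τ : (N.syncProd R).Policy} (hτ : τ.IsMemoryless) (x : S × Q) :
    ((N.syncProd R).induced τ).pr (.single _ x) {ω | R.IsAccepting fun n => (ω n).last.2} =
      (N.syncProd R).reach τ x (N.successSet R τ) := by
  let : MeasurableSpace (N.syncProd R).Path := ⊤
  let : MeasurableSpace (S × Q) := ⊤
  have hmap := MC.pathMeasure_map ((N.syncProd R).induced τ) ((N.syncProd R).stateChain τ)
    Path.last (fun π => by
      -- Memorylessness enters here: `stateChain` evaluates the policy on one-state paths only.
      rw [induced_P_map_last, hτ π (.single _ π.last) rfl]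
      rfl) (.single _ x)
  have hae := ((N.syncProd R).stateChain τ).ae_isAccepting_iff R x
  rw [show x = (Path.single (N.syncProd R) x).last from rfl, ← hmap] at hae
  refine measure_congr ?_
  filter_upwards [ae_of_ae_map (MC.measurable_comp_seq _).aemeasurable hae] with ω hω
  exact propext hω

end MDP

theorem mainTheorem3 {S Act AP Q : Type*} [Fintype S] [Finite Act] [Finite AP] [Finite Q]
    (M : MDP S Act (Set AP)) (m : ℕ) (hm : 0 < m) (φ : LTL AP m)
    (R : DRA Q (Fin m → Set AP)) (hR : ∀ w : ℕ → Fin m → Set AP, R.Accepts w ↔ φ.Sat w)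
    (s : Fin m → S) (σ : (M.selfComp m).Policy) :
    -- for every policy: the product turns satisfaction of `φ` into the Rabin condition
    (M.selfComp m).prLTL σ s φ =
        (((M.selfComp m).syncProd R).induced (σ.lift R)).pr
          (.single _ (s, R.δ R.q₀ ((M.selfComp m).L s)))
          {ω | R.IsAccepting fun n => (ω n).last.2} ∧
    -- for a memoryless policy: it is a reachability probability in the product
    (σ.IsMemoryless →
      (M.selfComp m).prLTL σ s φ =
        ((M.selfComp m).syncProd R).reach (σ.lift R) (s, R.δ R.q₀ ((M.selfComp m).L s))
          ((M.selfComp m).successSet R (σ.lift R))) := by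
  have h := (M.selfComp m).prLTL_eq_pr_isAccepting φ R hR s σ
  exact ⟨h, fun hσ => h.trans ((M.selfComp m).pr_isAccepting_eq_reach R (hσ.lift R) _)⟩
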